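/- Let $H$ be a real Hilbert space with inner product $\langle\cdot,\cdot\rangle$, identified with $H^*$ by the Riesz isomorphism, and let $B$ be a reflexive real Banach space, continuously and densely embedded in $H$. Then $B\subset H\subset B^*$, where $h\in H$ acts on $B$ by $b\mapsto\langle h,b\rangle$. "Smooth" means $C^\infty$ in the Fréchet sense. A (strong) symplectic form on an open set $U\subset H$ is a smooth closed 2-form $\Omega$ on $U$ such that, for each $u\in U$, the operator $J(u)\in\mathcal L(H)$ given by $\Omega(u)(X,Y)=\langle J(u)X,Y\rangle$ is an isomorphism of $H$. It is called $B$-compatible if there is an open set $V'\subset B^*$ with $U\subset V'$ such that $J$ and $J^{-1}$ extend to smooth maps $V'\to\mathcal L(B)$; that is, there are smooth $\tilde J,\tilde K:V'\to\mathcal L(B)$ with $\tilde J(u)b=J(u)b$ and $\tilde K(u)b=J(u)^{-1}b$ for all $u\in U$, $b\in B$. A $B$-regularizing 1-form on an open set $U'\subset B^*$ is a smooth map $F:U'\to\mathcal L(B^*,\mathbb R)=B^{**}\simeq B$; its exterior derivative is $dF(u)(X,Y)=(DF(u)X)(Y)-(DF(u)Y)(X)$, which is restricted to $X,Y\in H$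 in what follows. Let $U_1\subset H$ and $U_2\subset B^*$ be open with $U_1\subset U_2$, let $\Omega_1$ be a $B$-compatible symplectic form on $U_1$, and let $F$ be a $B$-regularizing 1-form on $U_2$. Let $u_0\in U_1$ with $F(u_0)=0$ and $DF(u_0)=0$, and set $\Omega_2:=\Omega_1+dF$ on $U_1$. Then there exist an open neighbourhood $V\subset U_2$ of $u_0$ in $B^*$, a map $\varphi\in C^\infty(V,B^*)$ with $\varphi-\mathrm{id}\in C^\infty(V,B)$ (so that $\varphi$ restricts to a smooth map $V\cap H\to H$) and a constant $C>0$ such that $$\|\varphi(u)-u\|_B\le C\,\|F(u)\|_B\qquad\text{for all }u\in V,$$ and such that $\varphi^*\Omega_2=\Omega_1$ near $u_0$ in the following sense: for every $u\in V\cap H$ for which the closed ball of $H$ with centre $u$ and radius $C\|F(u)\|_B$ is contained in $U_1$ (in particular, for every $u$ in some neighbourhood of $u_0$ in $H$), one has $\varphi(u)\in U_1$ and $$\Omega_2(\varphi(u))\bigl(D\varphi(u)X,D\varphi(u)Y\bigr)=\Omega_1(u)(X,Y)\qquad\text{for all }X,Y\in H.$$ -/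

import Mathlib

open scoped ContDiff RealInnerProductSpace Topology

noncomputable section

namespace Darboux

/-- A real normed space is reflexive if its canonical (isometric) embedding into the bidual is
onto. -/
def IsReflexive (B : Type*) [NormedAddCommGroup B] [NormedSpace ℝ B] : Prop :=
  Function.Surjective (NormedSpace.inclusionInDoubleDual ℝ B)

/-- The embedding `H ⊂ B*` induced by `i : B ⊂ H` and the Riesz identification `H ≃ H*`:
the vector `h` acts on `B` as `b ↦ ⟪h, i b⟫`. -/
def toDualB {B H : Type*} [NormedAddCommGroup B] [NormedSpace ℝ B]
    [NormedAddCommGroup H] [InnerProductSpace ℝ H] (i : B →L[ℝ] H) :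
    H →L[ℝ] StrongDual ℝ B :=
  (ContinuousLinearMap.precomp ℝ i).comp (innerSL ℝ : H →L[ℝ] H →L[ℝ] ℝ)

/-- The symplector `J` of an alternating bilinear form `σ` on `H`: the map
`v ↦ σ(v, ·) ∈ H*`, followed by the Riesz identification `H* ≃ H`. -/
def symplector {H : Type*} [NormedAddCommGroup H] [InnerProductSpace ℝ H] [CompleteSpace H]
    (σ : H [⋀^Fin 2]→L[ℝ] ℝ) : H →L[ℝ] H :=
  InnerProductSpace.continuousLinearMapOfBilin (𝕜 := ℝ)
    (((continuousMultilinearCurryFin1 ℝ H ℝ).toContinuousLinearEquiv :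
      (ContinuousMultilinearMap ℝ (fun _ : Fin 1 => H) ℝ) →L[ℝ] (H →L[ℝ] ℝ)).comp
      (ContinuousMultilinearMap.curryLeft σ.toContinuousMultilinearMap))

/-- `⟪J v, w⟫ = σ(v, w)`. -/
theorem inner_symplector {H : Type*} [NormedAddCommGroup H] [InnerProductSpace ℝ H]
    [CompleteSpace H] (σ : H [⋀^Fin 2]→L[ℝ] ℝ) (v w : H) :
    ⟪symplector σ v, w⟫ = σ ![v, w] := by
  refine (InnerProductSpace.continuousLinearMapOfBilin_apply (𝕜 := ℝ) _ v w).trans ?_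
  change σ (Fin.cons v _) = _
  congr 1
  ext j
  fin_cases j <;> rfl

/-- `⟨ι h, b⟩ = ⟪h, i b⟫`. -/
theorem toDualB_apply {B H : Type*} [NormedAddCommGroup B] [NormedSpace ℝ B]
    [NormedAddCommGroup H] [InnerProductSpace ℝ H] (i : B →L[ℝ] H) (h : H) (b : B) :
    toDualB i h b = ⟪h, i b⟫ := rfl

/-- A (strong) symplectic form on the open set `U ⊆ H`: a smooth closed 2-form whose symplector
is an isomorphism of `H` at every point of `U`. -/
structure IsSymplecticForm {H : Type*} [NormedAddCommGroup H] [InnerProductSpace ℝ H]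
    [CompleteSpace H] (U : Set H) (Ω : H → H [⋀^Fin 2]→L[ℝ] ℝ) : Prop where
  smooth : ContDiffOn ℝ ∞ Ω U
  closed : ∀ u ∈ U, extDeriv Ω u = 0
  nondegenerate : ∀ u ∈ U, (symplector (Ω u)).IsInvertible

/-- A symplectic form on `U` is `B`-compatible if, for some open `V ⊆ B*` containing `U`, the
symplector `J` and its inverse extend from `U` to smooth maps `V → L(B)`; that `Jt` extends `J`
means that, for `u ∈ U`, the operator `J(u)` restricts on `B ⊂ H` to `Jt(u)`. -/
structure IsCompatibleSymplecticForm {B H : Type*} [NormedAddCommGroup B] [NormedSpace ℝ B]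
    [NormedAddCommGroup H] [InnerProductSpace ℝ H] [CompleteSpace H] (i : B →L[ℝ] H)
    (U : Set H) (Ω : H → H [⋀^Fin 2]→L[ℝ] ℝ) : Prop extends IsSymplecticForm U Ω where
  extends_to_dual : ∃ V : Set (StrongDual ℝ B), IsOpen V ∧ (∀ u ∈ U, toDualB i u ∈ V) ∧
    ∃ Jt Kt : StrongDual ℝ B → (B →L[ℝ] B),
      ContDiffOn ℝ ∞ Jt V ∧ ContDiffOn ℝ ∞ Kt V ∧
      ∀ u ∈ U, ∀ b : B,
        i (Jt (toDualB i u) b) = symplector (Ω u) (i b) ∧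
        i (Kt (toDualB i u) b) = (symplector (Ω u)).inverse (i b)

/-- The exterior derivative `dF` of a 1-form `F` on a normed space (given as a map into the dual):
`dF(u)(X, Y) = (DF(u)X)(Y) - (DF(u)Y)(X)`. -/
def extDerivOneForm {E : Type*} [NormedAddCommGroup E] [NormedSpace ℝ E]
    (F : E → StrongDual ℝ E) : E → E [⋀^Fin 2]→L[ℝ] ℝ :=
  extDeriv fun u => ContinuousAlternatingMap.ofSubsingleton ℝ E ℝ (0 : Fin 1) (F u)

/-- The 2-form `Ω + dF` on `H`, where `F` is a 1-form on `B*` and `dF` is restricted to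
`H ⊂ B*`. -/
def addExtDeriv {B H : Type*} [NormedAddCommGroup B] [NormedSpace ℝ B]
    [NormedAddCommGroup H] [InnerProductSpace ℝ H] (i : B →L[ℝ] H)
    (Ω : H → H [⋀^Fin 2]→L[ℝ] ℝ) (F : StrongDual ℝ B → StrongDual ℝ (StrongDual ℝ B)) :
    H → H [⋀^Fin 2]→L[ℝ] ℝ :=
  fun u => Ω u + (extDerivOneForm F (toDualB i u)).compContinuousLinearMap (toDualB i)

/-- The pull-back `f^* Ω` of a 2-form: `(f^*Ω)(u)(X, Y) = Ω(f u)(Df(u)X, Df(u)Y)`. -/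
def pullback {H : Type*} [NormedAddCommGroup H] [NormedSpace ℝ H] (f : H → H)
    (Ω : H → H [⋀^Fin 2]→L[ℝ] ℝ) : H → H [⋀^Fin 2]→L[ℝ] ℝ :=
  fun u => (Ω (f u)).compContinuousLinearMap (fderiv ℝ f u)

end Darboux

end

universe u

noncomputable section

namespace Darboux

section Superposition

variable {K : Type*} [TopologicalSpace K]

/-- The superposition operator `γ ↦ f ∘ γ` on continuous maps, with junk value `0` when `f ∘ γ` is
not continuous. -/
def superposition (K : Type*) [TopologicalSpace K] {E F : Type*} [TopologicalSpace E]
    [TopologicalSpace F] [Zero F] (f : E → F) (γ : C(K, E)) : C(K, F) :=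
  ContinuousMap.mkD (f ∘ γ) 0

theorem superposition_apply {E F : Type*} [TopologicalSpace E]
    [TopologicalSpace F] [Zero F] {f : E → F} {O : Set E} (hf : ContinuousOn f O) {γ : C(K, E)}
    (hγ : ∀ s, γ s ∈ O) (s : K) : superposition K f γ s = f (γ s) :=
  ContinuousMap.mkD_apply_of_continuous (hf.comp_continuous γ.continuous hγ)

theorem continuousOn_superposition {E F : Type*} [TopologicalSpace E]
    [TopologicalSpace F] [Zero F] {f : E → F} {O : Set E} (hf : ContinuousOn f O) :
    ContinuousOn (superposition K f) {γ | ∀ s, γ s ∈ O} := by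
  rw [continuousOn_iff_continuous_domRestrict]
  let fO : C(O, F) := ⟨O.domRestrict f, hf.domRestrict⟩
  let lift : {γ : C(K, E) | ∀ s, γ s ∈ O} → C(K, O) := fun γ =>
    ⟨fun s => ⟨γ.1 s, γ.2 s⟩, by fun_prop⟩
  have hlift : Continuous lift :=
    (ContinuousMap.isInducing_postcomp (X := K) ⟨((↑) : O → E), continuous_subtype_val⟩
      Topology.IsInducing.subtypeVal).continuous_iff.2 continuous_subtype_val
  have := (ContinuousMap.continuous_postcomp (X := K) fO).comp hlift
  convert! this using 1
  ext γ s
  exact superposition_apply hf γ.2 s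

variable [CompactSpace K]

theorem isOpen_forall_mem {E : Type*} [TopologicalSpace E] {O : Set E} (hO : IsOpen O) :
    IsOpen {γ : C(K, E) | ∀ s, γ s ∈ O} := by
  simpa [Set.MapsTo] using
    (ContinuousMap.isOpen_setOfPred_mapsTo (X := K) (K := Set.univ) (U := O) isCompact_univ hO)

variable (K) in
/-- Pointwise application of a continuous family of operators to a continuous map. -/
def pointwiseApply (E F : Type*) [NormedAddCommGroup E] [NormedSpace ℝ E]
    [NormedAddCommGroup F] [NormedSpace ℝ F] :
    C(K, E →L[ℝ] F) →L[ℝ] C(K, E) →L[ℝ] C(K, F) :=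
  LinearMap.mkContinuous₂
    (LinearMap.mk₂ ℝ
      (fun (A : C(K, E →L[ℝ] F)) (γ : C(K, E)) => (⟨fun s => A s (γ s), by fun_prop⟩ : C(K, F)))
      (fun _ _ _ => by ext; simp) (fun _ _ _ => by ext; simp) (fun _ _ _ => by ext; simp)
      (fun _ _ _ => by ext; simp)) 1
    (fun A γ => by
      refine (ContinuousMap.norm_le _ (by positivity)).2 fun s => ?_
      refine ((A s).le_opNorm _).trans ?_
      rw [one_mul]
      gcongr
      exacts [A.norm_coe_le_norm s, γ.norm_coe_le_norm s])

@[simp]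
theorem pointwiseApply_apply {E F : Type*} [NormedAddCommGroup E] [NormedSpace ℝ E]
    [NormedAddCommGroup F] [NormedSpace ℝ F] (A : C(K, E →L[ℝ] F)) (γ : C(K, E)) (s : K) :
    pointwiseApply K E F A γ s = A s (γ s) := rfl

theorem hasFDerivAt_superposition {E F : Type*} [NormedAddCommGroup E] [NormedSpace ℝ E]
    [NormedAddCommGroup F] [NormedSpace ℝ F] {f : E → F} {O : Set E} (hO : IsOpen O)
    (hf : ContDiffOn ℝ 1 f O) {γ : C(K, E)} (hγ : ∀ s, γ s ∈ O) :
    HasFDerivAt (superposition K f)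
      (pointwiseApply K E F (superposition K (fderiv ℝ f) γ)) γ := by
  have hf' : ContinuousOn (fderiv ℝ f) O := hf.continuousOn_fderiv_of_isOpen hO le_rfl
  rw [hasFDerivAt_iff_isLittleO, Asymptotics.isLittleO_iff]
  intro ε hε
  have hev : ∀ᶠ η in 𝓝 γ, (∀ s, η s ∈ O) ∧
      dist (superposition K (fderiv ℝ f) η) (superposition K (fderiv ℝ f) γ) < ε :=
    Filter.Eventually.and ((isOpen_forall_mem hO).mem_nhds hγ)
      (Metric.continuousAt_iff'.1 ((continuousOn_superposition hf').continuousAt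
        ((isOpen_forall_mem hO).mem_nhds hγ)) ε hε)
  obtain ⟨δ, hδ, hball⟩ := Metric.eventually_nhds_iff_ball.1 hev
  filter_upwards [Metric.ball_mem_nhds γ hδ] with η hη
  refine (ContinuousMap.norm_le _ (by positivity)).2 fun s => ?_
  have hηs := (hball η hη).1
  simp only [ContinuousMap.sub_apply, pointwiseApply_apply, superposition_apply hf.continuousOn hγ,
    superposition_apply hf.continuousOn hηs, superposition_apply hf' hγ]
  have hseg : ∀ y ∈ segment ℝ (γ s) (η s), y ∈ O ∧ ‖fderiv ℝ f y - fderiv ℝ f (γ s)‖ ≤ ε := by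
    intro y hy
    rw [segment_eq_image'] at hy
    obtain ⟨θ, hθ, rfl⟩ := hy
    have hmem : γ + θ • (η - γ) ∈ Metric.ball γ δ :=
      (convex_ball γ δ).add_smul_sub_mem (Metric.mem_ball_self hδ) hη hθ
    obtain ⟨h1, h2⟩ := hball _ hmem
    refine ⟨h1 s, ?_⟩
    have h3 := (ContinuousMap.dist_apply_le_dist s).trans h2.le
    rw [superposition_apply hf' h1, superposition_apply hf' hγ, dist_eq_norm] at h3
    exact h3
  refine (Convex.norm_image_sub_le_of_norm_hasFDerivWithin_le' (f' := fderiv ℝ f) (C := ε)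
    (fun y hy => ?_) (fun y hy => (hseg y hy).2) (convex_segment (γ s) (η s))
    (left_mem_segment ℝ _ _) (right_mem_segment ℝ _ _)).trans ?_
  · exact (((hf.differentiableOn one_ne_zero).differentiableAt
      (hO.mem_nhds (hseg y hy).1)).hasFDerivAt).hasFDerivWithinAt
  · gcongr
    exact (η - γ).norm_coe_le_norm s

theorem contDiffOn_nat_superposition {E : Type u} [NormedAddCommGroup E] [NormedSpace ℝ E]
    {O : Set E} (hO : IsOpen O) (n : ℕ) : ∀ {F : Type u} [NormedAddCommGroup F] [NormedSpace ℝ F]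
    {f : E → F}, ContDiffOn ℝ n f O →
      ContDiffOn ℝ n (superposition K f) {γ | ∀ s, γ s ∈ O} := by
  induction n with
  | zero =>
    intro F _ _ f hf
    simp only [Nat.cast_zero, contDiffOn_zero] at hf ⊢
    exact continuousOn_superposition hf
  | succ n ih =>
    intro F _ _ f hf
    have h1 : ContDiffOn ℝ 1 f O := hf.of_le (by simp)
    have hd : ∀ γ ∈ {γ : C(K, E) | ∀ s, γ s ∈ O}, HasFDerivAt (superposition K f)
      (pointwiseApply K E F (superposition K (fderiv ℝ f) γ)) γ :=
      fun γ hγ => hasFDerivAt_superposition hO h1 hγ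
    push_cast at hf ⊢
    rw [contDiffOn_succ_iff_fderiv_of_isOpen (isOpen_forall_mem hO)]
    refine ⟨fun γ hγ => (hd γ hγ).differentiableAt.differentiableWithinAt, by simp, ?_⟩
    refine ContDiffOn.congr ?_ fun γ hγ => (hd γ hγ).fderiv
    exact (pointwiseApply K E F).contDiff.comp_contDiffOn
      (ih ((contDiffOn_succ_iff_fderiv_of_isOpen hO).1 hf).2.2)

/-- Composition with a smooth map is a smooth operation on continuous maps from a compact space. -/
theorem contDiffOn_superposition {E F : Type u} [NormedAddCommGroup E] [NormedSpace ℝ E]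
    [NormedAddCommGroup F] [NormedSpace ℝ F] {f : E → F} {O : Set E} (hO : IsOpen O)
    (hf : ContDiffOn ℝ ∞ f O) : ContDiffOn ℝ ∞ (superposition K f) {γ | ∀ s, γ s ∈ O} :=
  contDiffOn_infty.2 fun n => contDiffOn_nat_superposition hO n (contDiffOn_infty.1 hf n)

end Superposition

section Flow

open unitInterval

/-- The operator mapping a continuous path `γ` on `[0, 1]` to its primitive `t ↦ ∫₀ᵗ γ`. -/
def primitive (B : Type*) [NormedAddCommGroup B] [NormedSpace ℝ B] : C(I, B) →L[ℝ] C(I, B) :=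
  LinearMap.mkContinuous
    { toFun := fun γ => ⟨fun t => ∫ s in (0 : ℝ)..t, Set.IccExtend zero_le_one γ s,
        (intervalIntegral.continuous_primitive
          (fun a b => (γ.continuous.Icc_extend').intervalIntegrable a b) 0).comp
            continuous_subtype_val⟩
      map_add' := fun γ η => by
        ext t
        exact intervalIntegral.integral_add (γ.continuous.Icc_extend'.intervalIntegrable _ _)
          (η.continuous.Icc_extend'.intervalIntegrable _ _)
      map_smul' := fun c γ => by
        ext t
        exact intervalIntegral.integral_smul c _ } 1
    (fun γ => by
      refine (ContinuousMap.norm_le _ (by positivity)).2 fun t => ?_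
      refine (intervalIntegral.norm_integral_le_of_norm_le_const (C := ‖γ‖)
        fun s _ => γ.norm_coe_le_norm _).trans ?_
      rw [one_mul, sub_zero, abs_of_nonneg t.2.1]
      exact mul_le_of_le_one_right (norm_nonneg _) t.2.2)

theorem primitive_zero_right {B : Type*} [NormedAddCommGroup B] [NormedSpace ℝ B]
    (γ : C(I, B)) : primitive B γ 0 = 0 :=
  intervalIntegral.integral_same

theorem hasDerivWithinAt_primitive {B : Type*} [NormedAddCommGroup B] [NormedSpace ℝ B]
    [CompleteSpace B] (γ : C(I, B)) (t : I) :
    HasDerivWithinAt (Set.IccExtend zero_le_one (primitive B γ)) (γ t) I t := by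
  have h : Continuous (Set.IccExtend zero_le_one γ : ℝ → B) := γ.continuous.Icc_extend'
  have h1 := (intervalIntegral.integral_hasDerivAt_right (h.intervalIntegrable 0 t)
    (h.stronglyMeasurableAtFilter _ _) h.continuousAt).hasDerivWithinAt (s := I)
  rw [Set.IccExtend_val] at h1
  refine h1.congr (fun s hs => ?_) ?_
  · exact Set.IccExtend_of_mem zero_le_one _ hs
  · exact Set.IccExtend_val _ _ t

variable {E B : Type u} [NormedAddCommGroup E] [NormedSpace ℝ E] [NormedAddCommGroup B]
  [NormedSpace ℝ B]

/-- The linear part of `(u, γ) ↦ (s ↦ (s, u + j (γ s)))`. -/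
def shiftedGraphLinear (j : B →L[ℝ] E) : E × C(I, B) →L[ℝ] C(I, ℝ × E) :=
  LinearMap.mkContinuous
    { toFun := fun w => ⟨fun s => (0, w.1 + j (w.2 s)), by fun_prop⟩
      map_add' := fun w z => by
        ext s
        · simp
        · simp [add_add_add_comm]
      map_smul' := fun c w => by
        ext s
        · simp
        · simp } (1 + ‖j‖)
    (fun w => by
      refine (ContinuousMap.norm_le _ (by positivity)).2 fun s => ?_
      simp only [LinearMap.coe_mk, AddHom.coe_mk, ContinuousMap.coe_mk, Prod.norm_mk, norm_zero]
      refine max_le (by positivity) ((norm_add_le _ _).trans ?_)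
      rw [add_mul, one_mul]
      refine add_le_add (norm_fst_le w) ((j.le_opNorm _).trans ?_)
      gcongr
      exact (w.2.norm_coe_le_norm s).trans (norm_snd_le w))

theorem shiftedGraphLinear_apply (j : B →L[ℝ] E) (w : E × C(I, B)) (s : I) :
    shiftedGraphLinear j w s = (0, w.1 + j (w.2 s)) := rfl

/-- The path `s ↦ (s, u + j (γ s))`. -/
def shiftedGraph (j : B →L[ℝ] E) (w : E × C(I, B)) : C(I, ℝ × E) :=
  ⟨fun s => ((s : ℝ), 0), by fun_prop⟩ + shiftedGraphLinear j w

theorem shiftedGraph_apply (j : B →L[ℝ] E) (w : E × C(I, B)) (s : I) :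
    shiftedGraph j w s = ((s : ℝ), w.1 + j (w.2 s)) := by
  simp [shiftedGraph, shiftedGraphLinear_apply]

theorem contDiff_shiftedGraph (j : B →L[ℝ] E) {n : ℕ∞ω} : ContDiff ℝ n (shiftedGraph j) :=
  contDiff_const.add (shiftedGraphLinear j).contDiff

theorem hasFDerivAt_shiftedGraph (j : B →L[ℝ] E) (w : E × C(I, B)) :
    HasFDerivAt (shiftedGraph j) (shiftedGraphLinear j) w :=
  (shiftedGraphLinear j).hasFDerivAt.const_add _

/-- A time-dependent vector field `X` that vanishes to first order at `u₀` has a smooth flow on the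
time interval `[0, 1]` near `u₀`. It is written as `u ↦ u + j (Γ u t)`, where `j ∘ X` is the field;
its derivative satisfies the variational equation. -/
theorem exists_smooth_flow [CompleteSpace E] [CompleteSpace B] (j : B →L[ℝ] E) {X : ℝ × E → B}
    {O : Set (ℝ × E)} (hO : IsOpen O) (hX : ContDiffOn ℝ ∞ X O) {u₀ : E}
    (hmem : ∀ t : I, ((t : ℝ), u₀) ∈ O) (hX₀ : ∀ t : I, X (t, u₀) = 0)
    (hDX₀ : ∀ t : I, ∀ h : E, fderiv ℝ X (t, u₀) (0, h) = 0) :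
    ∃ V : Set E, IsOpen V ∧ u₀ ∈ V ∧ ∃ Γ : E → C(I, B), ContDiffOn ℝ ∞ Γ V ∧
      ∀ u ∈ V, Γ u 0 = 0 ∧ (∀ h, fderiv ℝ Γ u h 0 = 0) ∧
        ∀ t : I, ((t : ℝ), u + j (Γ u t)) ∈ O ∧
          HasDerivWithinAt (Set.IccExtend zero_le_one (Γ u)) (X (t, u + j (Γ u t))) I t ∧
          ∀ h, HasDerivWithinAt (Set.IccExtend zero_le_one (fderiv ℝ Γ u h))
            (fderiv ℝ X (t, u + j (Γ u t)) (0, h + j (fderiv ℝ Γ u h t))) I t := by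
  set S : Set (E × C(I, B)) := {w | ∀ s, shiftedGraph j w s ∈ O} with hS
  have hSo : IsOpen S := (isOpen_forall_mem hO).preimage
    (contDiff_shiftedGraph (n := 0) j).continuous
  set G : E × C(I, B) → C(I, B) := fun w => primitive B (superposition I X (shiftedGraph j w))
    with hG
  have hGsmooth : ContDiffOn ℝ ∞ G S :=
    (primitive B).contDiff.comp_contDiffOn
      ((contDiffOn_superposition hO hX).comp (contDiff_shiftedGraph j).contDiffOn fun w hw => hw)
  have hX1 : ContDiffOn ℝ 1 X O := hX.of_le (by simp)
  have hX' : ContinuousOn (fderiv ℝ X) O := hX1.continuousOn_fderiv_of_isOpen hO le_rfl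
  have hGderiv : ∀ w ∈ S, HasFDerivAt G (primitive B ∘L
      (pointwiseApply I (ℝ × E) B (superposition I (fderiv ℝ X) (shiftedGraph j w))) ∘L
        shiftedGraphLinear j) w := fun w hw =>
    (primitive B).hasFDerivAt.comp w
      ((hasFDerivAt_superposition hO hX1 hw).comp w (hasFDerivAt_shiftedGraph j w))
  set Ψ : E × C(I, B) → E × C(I, B) := fun w => (w.1, w.2 - G w) with hΨ
  have hΨsmooth : ContDiffOn ℝ ∞ Ψ S :=
    contDiff_fst.contDiffOn.prodMk (contDiff_snd.contDiffOn.sub hGsmooth)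
  set w₀ : E × C(I, B) := (u₀, 0) with hw₀
  have hw₀S : w₀ ∈ S := fun s => by simpa [shiftedGraph_apply, w₀] using hmem s
  have hG₀ : G w₀ = 0 := by
    have : superposition I X (shiftedGraph j w₀) = 0 := by
      ext s
      rw [superposition_apply hX.continuousOn hw₀S, shiftedGraph_apply]
      simpa [w₀] using hX₀ s
    simp [hG, this]
  have hDG₀ : HasFDerivAt G (0 : E × C(I, B) →L[ℝ] C(I, B)) w₀ := by
    convert! hGderiv w₀ hw₀S using 1
    symm
    refine ContinuousLinearMap.ext fun w => ?_
    have : pointwiseApply I (ℝ × E) B (superposition I (fderiv ℝ X) (shiftedGraph j w₀))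
        (shiftedGraphLinear j w) = 0 := by
      ext s
      rw [pointwiseApply_apply, superposition_apply hX' hw₀S, shiftedGraph_apply,
        shiftedGraphLinear_apply]
      simpa [w₀] using hDX₀ s _
    simp [this]
  have hDΨ₀ : HasFDerivAt Ψ
      ((ContinuousLinearEquiv.refl ℝ (E × C(I, B)) : E × C(I, B) →L[ℝ] E × C(I, B))) w₀ := by
    have := hasFDerivAt_fst.prodMk ((hasFDerivAt_snd (𝕜 := ℝ) (p := w₀)).sub hDG₀)
    convert! this using 1
    ext <;> simp
  have hΨ₀ : ContDiffAt ℝ ∞ Ψ w₀ := hΨsmooth.contDiffAt (hSo.mem_nhds hw₀S)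
  set e := hΨ₀.toOpenPartialHomeomorph Ψ hDΨ₀ (by simp) with he
  have hecoe : (e : E × C(I, B) → E × C(I, B)) = Ψ := rfl
  have hw₀e : w₀ ∈ e.source := hΨ₀.mem_toOpenPartialHomeomorph_source hDΨ₀ (by simp)
  set N : Set (E × C(I, B)) := S ∩ fderiv ℝ Ψ ⁻¹'
    Set.range ((↑) : ((E × C(I, B)) ≃L[ℝ] (E × C(I, B))) → _) with hN
  have hNo : IsOpen N := ((hΨsmooth.of_le (m := 1) (by simp)).continuousOn_fderiv_of_isOpen hSo
    le_rfl).isOpen_inter_preimage hSo ContinuousLinearEquiv.isOpen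
  have hw₀N : w₀ ∈ N := ⟨hw₀S, ⟨ContinuousLinearEquiv.refl ℝ _, hDΨ₀.fderiv.symm⟩⟩
  set T : Set (E × C(I, B)) := e.target ∩ e.symm ⁻¹' N with hT
  have hTo : IsOpen T := e.isOpen_inter_preimage_symm hNo
  have hΨw₀ : Ψ w₀ = (u₀, 0) := by simp [hΨ, hG₀, w₀]
  have hT₀ : (u₀, (0 : C(I, B))) ∈ T := by
    rw [← hΨw₀, ← hecoe]
    exact ⟨e.map_source hw₀e, by simpa [e.left_inv hw₀e] using hw₀N⟩
  have hsymm : ContDiffOn ℝ ∞ e.symm T := fun w hw => by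
    obtain ⟨hwS, f', hf'⟩ := hw.2
    have hd : ContDiffAt ℝ ∞ Ψ (e.symm w) := hΨsmooth.contDiffAt (hSo.mem_nhds hwS)
    refine (e.contDiffAt_symm (f₀' := f') hw.1 ?_ hd).contDiffWithinAt
    rw [hf']
    exact (hd.differentiableAt (by simp)).hasFDerivAt
  set V : Set E := (fun u => (u, (0 : C(I, B)))) ⁻¹' T with hV
  have hVo : IsOpen V := hTo.preimage (by fun_prop)
  set Γ : E → C(I, B) := fun u => (e.symm (u, 0)).2 with hΓ
  have hΓsmooth : ContDiffOn ℝ ∞ Γ V :=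
    contDiff_snd.comp_contDiffOn (hsymm.comp (by fun_prop) fun u hu => hu)
  have hsol : ∀ u ∈ V, (u, Γ u) ∈ S ∧ Γ u = G (u, Γ u) := fun u hu => by
    have h1 : Ψ (e.symm (u, 0)) = (u, 0) := e.right_inv hu.1
    have h2 : (e.symm (u, 0)).1 = u := congrArg Prod.fst h1
    have h3 : e.symm (u, 0) = (u, Γ u) := Prod.ext h2 rfl
    rw [h3] at h1
    refine ⟨?_, sub_eq_zero.1 (congrArg Prod.snd h1)⟩
    rw [← h3]
    exact hu.2.1
  refine ⟨V, hVo, hT₀, Γ, hΓsmooth, fun u hu => ?_⟩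
  obtain ⟨huS, huG⟩ := hsol u hu
  have hDΓ : HasFDerivAt Γ (fderiv ℝ Γ u) u :=
    ((hΓsmooth.differentiableOn (by simp)).differentiableAt (hVo.mem_nhds hu)).hasFDerivAt
  have hDΓ' : ∀ h, fderiv ℝ Γ u h = primitive B
      (pointwiseApply I (ℝ × E) B (superposition I (fderiv ℝ X) (shiftedGraph j (u, Γ u)))
        (shiftedGraphLinear j (h, fderiv ℝ Γ u h))) := fun h => by
    have h1 := (hGderiv _ huS).comp u ((hasFDerivAt_id u).prodMk hDΓ)
    have h2 : Γ =ᶠ[𝓝 u] G ∘ fun u => (id u, Γ u) := by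
      filter_upwards [hVo.mem_nhds hu] with v hv using (hsol v hv).2
    exact congrArg (fun L => L h) (hDΓ.unique (h1.congr_of_eventuallyEq h2))
  refine ⟨?_, fun h => ?_, fun t => ⟨?_, ?_, fun h => ?_⟩⟩
  · rw [huG]
    exact primitive_zero_right _
  · rw [hDΓ' h]
    exact primitive_zero_right _
  · simpa [shiftedGraph_apply] using huS t
  · have h1 := hasDerivWithinAt_primitive (superposition I X (shiftedGraph j (u, Γ u))) t
    rwa [superposition_apply hX.continuousOn huS, shiftedGraph_apply,
      show primitive B (superposition I X (shiftedGraph j (u, Γ u))) = Γ u from huG.symm] at h1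
  · have h1 := hasDerivWithinAt_primitive
      (pointwiseApply I (ℝ × E) B (superposition I (fderiv ℝ X) (shiftedGraph j (u, Γ u)))
        (shiftedGraphLinear j (h, fderiv ℝ Γ u h))) t
    rwa [← hDΓ' h, pointwiseApply_apply, superposition_apply hX' huS, shiftedGraph_apply,
      shiftedGraphLinear_apply] at h1

end Flow

section Moser

variable {E : Type*} [NormedAddCommGroup E] [NormedSpace ℝ E]

theorem hasFDerivAt_clm_comp {F G : Type*} [NormedAddCommGroup F] [NormedSpace ℝ F]
    [NormedAddCommGroup G] [NormedSpace ℝ G] (L : F →L[ℝ] G) {f : E → F} {u : E}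
    (hf : DifferentiableAt ℝ f u) : HasFDerivAt (fun v => L (f v)) (L ∘L fderiv ℝ f u) u :=
  L.hasFDerivAt.comp u hf.hasFDerivAt

theorem hasDerivWithinAt_fderiv_comp {F : Type*} [NormedAddCommGroup F] [NormedSpace ℝ F]
    {f : E → F} {f' : E →L[ℝ] F} {x : ℝ → E} {x' : E} {t : ℝ} {s : Set ℝ}
    (hf : HasFDerivAt f f' (x t)) (hx : HasDerivWithinAt x x' s t) :
    HasDerivWithinAt (fun τ => f (x τ)) (f' x') s t :=
  hf.comp_hasDerivWithinAt t hx

/-- The bilinear map `v, w ↦ σ(v, w)` of an alternating 2-form. -/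
def toBilin (E : Type*) [NormedAddCommGroup E] [NormedSpace ℝ E] :
    (E [⋀^Fin 2]→L[ℝ] ℝ) →L[ℝ] E →L[ℝ] E →L[ℝ] ℝ :=
  (ContinuousLinearMap.postcomp E (ContinuousAlternatingMap.ofSubsingletonLIE
      (𝕜 := ℝ) (E := E) (F := ℝ) (0 : Fin 1)).symm.toContinuousLinearEquiv.toContinuousLinearMap)
    ∘L (ContinuousAlternatingMap.curryLeftLI (𝕜 := ℝ) (E := E) (F := ℝ)
      (n := 1)).toContinuousLinearMap

theorem toBilin_apply (σ : E [⋀^Fin 2]→L[ℝ] ℝ) (v w : E) : toBilin E σ v w = σ ![v, w] := by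
  change σ (Matrix.vecCons v _) = _
  congr 1
  ext j
  fin_cases j <;> rfl

theorem extDeriv_apply_two {α : E → E →L[ℝ] ℝ} {u : E} (hα : DifferentiableAt ℝ α u) (v w : E) :
    extDeriv (fun u => ContinuousAlternatingMap.ofSubsingleton ℝ E ℝ (0 : Fin 1) (α u)) u ![v, w] =
      fderiv ℝ α u v w - fderiv ℝ α u w v := by
  have hd : DifferentiableAt ℝ
      (fun u => ContinuousAlternatingMap.ofSubsingleton ℝ E ℝ (0 : Fin 1) (α u)) u :=
    (ContinuousAlternatingMap.ofSubsingletonLIE (𝕜 := ℝ) (E := E) (F := ℝ)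
      (0 : Fin 1)).differentiableAt.comp u hα
  rw [extDeriv_apply hd]
  have key : ∀ x y : E, fderiv ℝ (fun u => α u x) u y = fderiv ℝ α u y x := fun x y => by
    rw [fderiv_clm_apply hα (differentiableAt_const x)]
    simp
  simp [Fin.sum_univ_two, key, Fin.removeNth, sub_eq_add_neg]

theorem extDeriv_apply_three {Ω : E → E [⋀^Fin 2]→L[ℝ] ℝ} {u : E} (hΩ : DifferentiableAt ℝ Ω u)
    (a b c : E) : extDeriv Ω u ![a, b, c] =
      fderiv ℝ Ω u a ![b, c] - fderiv ℝ Ω u b ![a, c] + fderiv ℝ Ω u c ![a, b] := by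
  rw [extDeriv_apply hΩ]
  have key : ∀ (x : Fin 2 → E) (y : E), fderiv ℝ (fun u => Ω u x) u y = fderiv ℝ Ω u y x :=
    fun x y => by rw [fderiv_continuousAlternatingMap_apply_const_apply hΩ]
  simp [Fin.sum_univ_three, key, sub_eq_add_neg]
  have h1 : Fin.removeNth 1 ![a, b, c] = ![a, c] := by
    ext k
    fin_cases k <;> rfl
  have h2 : Fin.removeNth 2 ![a, b, c] = ![a, b] := by
    ext k
    fin_cases k <;> rfl
  rw [h1, h2]

theorem hasFDerivAt_bilin_apply_left {β : E → E →L[ℝ] E →L[ℝ] ℝ} {β' : E →L[ℝ] E →L[ℝ] E →L[ℝ] ℝ}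
    {Y : E → E} {Y' : E →L[ℝ] E} {u : E} (hβ : HasFDerivAt β β' u) (hY : HasFDerivAt Y Y' u)
    (w : E) : HasFDerivAt (fun v => β v (Y v) w) ((β u).flip w ∘L Y' + (β'.flip (Y u)).flip w) u := by
  have h1 : HasFDerivAt (fun v => β v (Y v)) (β u ∘L Y' + β'.flip (Y u)) u := hβ.clm_apply hY
  have h2 := h1.clm_apply (hasFDerivAt_const w u)
  refine h2.congr_fderiv ?_
  ext p
  simp

theorem hasDerivWithinAt_bilin_apply {β : E → E →L[ℝ] E →L[ℝ] ℝ}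
    {β' : E →L[ℝ] E →L[ℝ] E →L[ℝ] ℝ} {x a b : ℝ → E} {x' a' b' : E} {t : ℝ} {s : Set ℝ}
    (hβ : HasFDerivAt β β' (x t)) (hx : HasDerivWithinAt x x' s t)
    (ha : HasDerivWithinAt a a' s t) (hb : HasDerivWithinAt b b' s t) :
    HasDerivWithinAt (fun τ => β (x τ) (a τ) (b τ))
      (β' x' (a t) (b t) + β (x t) a' (b t) + β (x t) (a t) b') s t := by
  have h1 : HasDerivWithinAt (fun τ => β (x τ)) (β' x') s t :=
    hasDerivWithinAt_fderiv_comp (F := E →L[ℝ] E →L[ℝ] ℝ) hβ hx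
  have h2 : HasDerivWithinAt (fun τ => β (x τ) (a τ)) (β' x' (a t) + β (x t) a') s t :=
    h1.clm_apply ha
  exact h2.clm_apply hb

/-- Moser's computation: along a path `x` driven by a field `Y` with
`(β + t γ)(Y, ·) = -α`, where `γ = dα`, and for solutions `a, b` of the variational equation, the
quantity `(β + t γ)(x)(a, b)` has derivative zero. -/
theorem hasDerivWithinAt_moser_bilin {β γ : E → E →L[ℝ] E →L[ℝ] ℝ} {α : E → E →L[ℝ] ℝ} {t : ℝ}
    {β' γ' : E →L[ℝ] E →L[ℝ] E →L[ℝ] ℝ} {α' : E →L[ℝ] E →L[ℝ] ℝ}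
    {Y : E → E} {Y' : E →L[ℝ] E} {x a b : ℝ → E} {s : Set ℝ}
    (hβ : HasFDerivAt β β' (x t)) (hγ : HasFDerivAt γ γ' (x t)) (hα : HasFDerivAt α α' (x t))
    (hdβ : ∀ p q r, β' p q r - β' q p r + β' r p q = 0)
    (hdγ : ∀ p q r, γ' p q r - γ' q p r + γ' r p q = 0)
    (hβa : ∀ v w, β (x t) v w = - β (x t) w v)
    (hγα : ∀ v w, γ (x t) v w = α' v w - α' w v)
    (hY : HasFDerivAt Y Y' (x t))
    (hYα : ∀ᶠ v in 𝓝 (x t), ∀ w, β v (Y v) w + t * γ v (Y v) w = - α v w)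
    (hx : HasDerivWithinAt x (Y (x t)) s t) (ha : HasDerivWithinAt a (Y' (a t)) s t)
    (hb : HasDerivWithinAt b (Y' (b t)) s t) :
    HasDerivWithinAt (fun τ => β (x τ) (a τ) (b τ) + τ * γ (x τ) (a τ) (b τ)) 0 s t := by
  have hident : ∀ p w : E, β' p (Y (x t)) w + β (x t) (Y' p) w
      + t * (γ' p (Y (x t)) w + γ (x t) (Y' p) w) = - α' p w := fun p w => by
    have h1 := (hasFDerivAt_bilin_apply_left hβ hY w).add
      ((hasFDerivAt_bilin_apply_left hγ hY w).const_mul t)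
    have h2 : HasFDerivAt (fun v => - α v w) (-(α'.flip w)) (x t) :=
      ((ContinuousLinearMap.apply ℝ ℝ w).hasFDerivAt.comp (x t) hα).neg
    have h3 := h1.unique (h2.congr_of_eventuallyEq (hYα.mono fun v hv => hv w))
    have h4 := DFunLike.congr_fun h3 p
    simp only [_root_.add_apply, ContinuousLinearMap.comp_apply,
      ContinuousLinearMap.flip_apply, _root_.smul_apply, smul_eq_mul,
      _root_.neg_apply] at h4
    linear_combination h4
  refine ((hasDerivWithinAt_bilin_apply hβ hx ha hb).add ((hasDerivWithinAt_id t s).mul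
    (hasDerivWithinAt_bilin_apply hγ hx ha hb))).congr_deriv ?_
  simp only [id_eq]
  linear_combination hident (a t) (b t) - hident (b t) (a t) + hdβ (Y (x t)) (a t) (b t)
    + t * hdγ (Y (x t)) (a t) (b t) + hβa (a t) (Y' (b t)) + t * hγα (a t) (Y' (b t))
    + t * hγα (Y' (b t)) (a t) + hγα (a t) (b t)

theorem hasDerivWithinAt_moser {Ω η : E → E [⋀^Fin 2]→L[ℝ] ℝ} {α : E → E →L[ℝ] ℝ} {t : ℝ}
    {Y : E → E} {Y' : E →L[ℝ] E} {x a b : ℝ → E} {s : Set ℝ}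
    (hΩ : DifferentiableAt ℝ Ω (x t)) (hη : DifferentiableAt ℝ η (x t))
    (hα : DifferentiableAt ℝ α (x t))
    (hdΩ : extDeriv Ω (x t) = 0) (hdη : extDeriv η (x t) = 0)
    (hηα : ∀ v w, η (x t) ![v, w] = fderiv ℝ α (x t) v w - fderiv ℝ α (x t) w v)
    (hY : HasFDerivAt Y Y' (x t))
    (hYα : ∀ᶠ v in 𝓝 (x t), ∀ w, Ω v ![Y v, w] + t * η v ![Y v, w] = - α v w)
    (hx : HasDerivWithinAt x (Y (x t)) s t) (ha : HasDerivWithinAt a (Y' (a t)) s t)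
    (hb : HasDerivWithinAt b (Y' (b t)) s t) :
    HasDerivWithinAt (fun τ => Ω (x τ) ![a τ, b τ] + τ * η (x τ) ![a τ, b τ]) 0 s t := by
  have hclosed : ∀ {ζ : E → E [⋀^Fin 2]→L[ℝ] ℝ}, DifferentiableAt ℝ ζ (x t) →
      extDeriv ζ (x t) = 0 → ∀ p q r, (toBilin E ∘L fderiv ℝ ζ (x t)) p q r
        - (toBilin E ∘L fderiv ℝ ζ (x t)) q p r + (toBilin E ∘L fderiv ℝ ζ (x t)) r p q = 0 := by
    intro ζ hζ hdζ p q r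
    have h := extDeriv_apply_three hζ p q r
    rw [hdζ] at h
    simp only [ContinuousLinearMap.comp_apply, toBilin_apply]
    exact h.symm
  have hbil : ∀ {ζ : E → E [⋀^Fin 2]→L[ℝ] ℝ}, DifferentiableAt ℝ ζ (x t) →
      HasFDerivAt (fun v => toBilin E (ζ v)) (toBilin E ∘L fderiv ℝ ζ (x t)) (x t) := fun hζ =>
    hasFDerivAt_clm_comp (F := E [⋀^Fin 2]→L[ℝ] ℝ) (G := E →L[ℝ] E →L[ℝ] ℝ) (toBilin E) hζ
  have h := hasDerivWithinAt_moser_bilin (β := fun v => toBilin E (Ω v))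
    (γ := fun v => toBilin E (η v)) (α := α) (t := t) (Y := Y) (Y' := Y') (x := x) (a := a) (b := b)
    (s := s) (hbil hΩ) (hbil hη) hα.hasFDerivAt
    (hclosed hΩ hdΩ) (hclosed hη hdη)
    (fun v w => by
      rw [toBilin_apply, toBilin_apply]
      have := (Ω (x t)).map_swap ![v, w] (i := 0) (j := 1) (by simp)
      have h2 : ![v, w] ∘ Equiv.swap (0 : Fin 2) 1 = ![w, v] := by
        ext k
        fin_cases k <;> simp
      rw [h2] at this
      exact neg_eq_iff_eq_neg.1 this.symm)
    (fun v w => by rw [toBilin_apply, hηα]) hY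
    (by simpa only [toBilin_apply] using hYα) hx ha hb
  simpa only [toBilin_apply] using h

end Moser

set_option maxSynthPendingDepth 3

section Field

open unitInterval

variable {B H : Type*} [NormedAddCommGroup B] [NormedSpace ℝ B]
  [NormedAddCommGroup H] [InnerProductSpace ℝ H]

/-- The canonical isometry of a reflexive space with its bidual. -/
def IsReflexive.equiv (hB : IsReflexive B) : B ≃ₗᵢ[ℝ] StrongDual ℝ (StrongDual ℝ B) :=
  LinearIsometryEquiv.ofSurjective (NormedSpace.inclusionInDoubleDualLi ℝ) hB

theorem IsReflexive.equiv_symm_apply (hB : IsReflexive B) (z : StrongDual ℝ (StrongDual ℝ B))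
    (f : StrongDual ℝ B) : f (hB.equiv.symm z) = z f := by
  obtain ⟨b, rfl⟩ := hB.equiv.surjective z
  rw [LinearIsometryEquiv.symm_apply_apply]
  rfl

variable (hB : IsReflexive B) (i : B →L[ℝ] H)

/-- The operator on `B` that represents the 2-form `dF(u)`, where `L = DF(u)`. -/
def skewPart : (StrongDual ℝ B →L[ℝ] StrongDual ℝ (StrongDual ℝ B)) →L[ℝ] (B →L[ℝ] B) :=
  (ContinuousLinearMap.precomp B (toDualB i ∘L i)) ∘L
    (ContinuousLinearMap.postcomp (StrongDual ℝ B)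
      (hB.equiv.symm.toContinuousLinearEquiv : StrongDual ℝ (StrongDual ℝ B) →L[ℝ] B)) ∘L
    (ContinuousLinearMap.id ℝ _ - (ContinuousLinearMap.flipₗᵢ ℝ (StrongDual ℝ B) (StrongDual ℝ B)
      ℝ).toContinuousLinearEquiv.toContinuousLinearMap)

theorem skewPart_apply (L : StrongDual ℝ B →L[ℝ] StrongDual ℝ (StrongDual ℝ B)) (b : B)
    (f : StrongDual ℝ B) :
    f (skewPart hB i L b) = L (toDualB i (i b)) f - L f (toDualB i (i b)) := by
  change f (hB.equiv.symm (L (toDualB i (i b)) - L.flip (toDualB i (i b)))) = _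
  rw [hB.equiv_symm_apply]
  rfl

/-- The operator on `B` that represents the 2-form `Ω + t dF` at `u`. -/
def interpolatedSymplector (Jt : StrongDual ℝ B → (B →L[ℝ] B))
    (F : StrongDual ℝ B → StrongDual ℝ (StrongDual ℝ B)) (p : ℝ × StrongDual ℝ B) : B →L[ℝ] B :=
  Jt p.2 + p.1 • skewPart hB i (fderiv ℝ F p.2)

/-- The Moser vector field `X` with `(Ω + t dF)(X, ·) = -F`. -/
def moserField (Jt : StrongDual ℝ B → (B →L[ℝ] B))
    (F : StrongDual ℝ B → StrongDual ℝ (StrongDual ℝ B)) (p : ℝ × StrongDual ℝ B) : B :=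
  -((interpolatedSymplector hB i Jt F p).inverse (hB.equiv.symm (F p.2)))

variable {hB i}

theorem moserField_spec [CompleteSpace H] {Jt : StrongDual ℝ B → (B →L[ℝ] B)}
    {F : StrongDual ℝ B → StrongDual ℝ (StrongDual ℝ B)} {Ω : H → H [⋀^Fin 2]→L[ℝ] ℝ}
    {t : ℝ} {u : H} (hJ : ∀ b, i (Jt (toDualB i u) b) = symplector (Ω u) (i b))
    (hF : DifferentiableAt ℝ F (toDualB i u))
    (hinv : (interpolatedSymplector hB i Jt F (t, toDualB i u)).IsInvertible) (w : H) :
    Ω u ![i (moserField hB i Jt F (t, toDualB i u)), w]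
      + t * (extDerivOneForm F (toDualB i u)).compContinuousLinearMap (toDualB i)
        ![i (moserField hB i Jt F (t, toDualB i u)), w] = - F (toDualB i u) (toDualB i w) := by
  set x := moserField hB i Jt F (t, toDualB i u) with hx
  have hMx : interpolatedSymplector hB i Jt F (t, toDualB i u) x
      = - hB.equiv.symm (F (toDualB i u)) := by
    rw [hx, moserField, map_neg, hinv.self_apply_inverse]
  have h1 : Ω u ![i x, w] = toDualB i w (Jt (toDualB i u) x) := by
    rw [← inner_symplector, ← hJ, toDualB_apply, real_inner_comm]
  have h2 : (extDerivOneForm F (toDualB i u)).compContinuousLinearMap (toDualB i) ![i x, w]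
      = toDualB i w (skewPart hB i (fderiv ℝ F (toDualB i u)) x) := by
    rw [skewPart_apply, ← extDeriv_apply_two hF]
    change extDerivOneForm F (toDualB i u) (toDualB i ∘ ![i x, w]) = _
    congr 1
    ext k
    fin_cases k <;> rfl
  have h3 := congrArg (toDualB i w) hMx
  rw [map_neg, hB.equiv_symm_apply] at h3
  rw [h1, h2, ← h3]
  simp [interpolatedSymplector]

theorem contDiffOn_interpolatedSymplector {Jt : StrongDual ℝ B → (B →L[ℝ] B)}
    {F : StrongDual ℝ B → StrongDual ℝ (StrongDual ℝ B)} {W : Set (StrongDual ℝ B)}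
    (hW : IsOpen W) (hJt : ContDiffOn ℝ ∞ Jt W) (hF : ContDiffOn ℝ ∞ F W) :
    ContDiffOn ℝ ∞ (interpolatedSymplector hB i Jt F) (Prod.snd ⁻¹' W) := by
  have h1 : ContDiffOn ℝ ∞ (fderiv ℝ F) W := hF.fderiv_of_isOpen hW (by simp)
  have h2 : Set.MapsTo (Prod.snd : ℝ × StrongDual ℝ B → _) (Prod.snd ⁻¹' W) W := fun _ h => h
  exact (hJt.comp contDiff_snd.contDiffOn h2).add (contDiff_fst.contDiffOn.smul
    ((skewPart hB i).contDiff.comp_contDiffOn (h1.comp contDiff_snd.contDiffOn h2)))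

theorem moserField_eq_zero {Jt : StrongDual ℝ B → (B →L[ℝ] B)}
    {F : StrongDual ℝ B → StrongDual ℝ (StrongDual ℝ B)} {p : ℝ × StrongDual ℝ B}
    (h : F p.2 = 0) : moserField hB i Jt F p = 0 := by
  simp [moserField, h]

variable [CompleteSpace B]

theorem isOpen_invertible_interpolatedSymplector {Jt : StrongDual ℝ B → (B →L[ℝ] B)}
    {F : StrongDual ℝ B → StrongDual ℝ (StrongDual ℝ B)} {W : Set (StrongDual ℝ B)}
    (hW : IsOpen W) (hJt : ContDiffOn ℝ ∞ Jt W) (hF : ContDiffOn ℝ ∞ F W) :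
    IsOpen {p : ℝ × StrongDual ℝ B | p.2 ∈ W ∧
      (interpolatedSymplector hB i Jt F p).IsInvertible} :=
  (contDiffOn_interpolatedSymplector hW hJt hF).continuousOn.isOpen_inter_preimage
    (hW.preimage continuous_snd) ContinuousLinearEquiv.isOpen

theorem contDiffOn_inverse_interpolatedSymplector {Jt : StrongDual ℝ B → (B →L[ℝ] B)}
    {F : StrongDual ℝ B → StrongDual ℝ (StrongDual ℝ B)} {W : Set (StrongDual ℝ B)}
    (hW : IsOpen W) (hJt : ContDiffOn ℝ ∞ Jt W) (hF : ContDiffOn ℝ ∞ F W) :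
    ContDiffOn ℝ ∞ (fun p => (interpolatedSymplector hB i Jt F p).inverse)
      {p : ℝ × StrongDual ℝ B | p.2 ∈ W ∧ (interpolatedSymplector hB i Jt F p).IsInvertible} := by
  rintro p ⟨hp, f, hf⟩
  have h := (contDiffOn_interpolatedSymplector (hB := hB) (i := i) hW hJt hF).contDiffAt
    ((hW.preimage continuous_snd).mem_nhds hp)
  have h2 : ContDiffAt ℝ ∞ ContinuousLinearMap.inverse (interpolatedSymplector hB i Jt F p) :=
    hf ▸ contDiffAt_map_inverse f
  exact (h2.comp p h).contDiffWithinAt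

theorem contDiffOn_moserField {Jt : StrongDual ℝ B → (B →L[ℝ] B)}
    {F : StrongDual ℝ B → StrongDual ℝ (StrongDual ℝ B)} {W : Set (StrongDual ℝ B)}
    (hW : IsOpen W) (hJt : ContDiffOn ℝ ∞ Jt W) (hF : ContDiffOn ℝ ∞ F W) :
    ContDiffOn ℝ ∞ (moserField hB i Jt F)
      {p : ℝ × StrongDual ℝ B | p.2 ∈ W ∧ (interpolatedSymplector hB i Jt F p).IsInvertible} :=
  ((contDiffOn_inverse_interpolatedSymplector hW hJt hF).clm_apply
    (hB.equiv.symm.contDiff.comp_contDiffOn (hF.comp contDiff_snd.contDiffOn fun _ h => h.1))).neg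

theorem fderiv_moserField_eq_zero {Jt : StrongDual ℝ B → (B →L[ℝ] B)}
    {F : StrongDual ℝ B → StrongDual ℝ (StrongDual ℝ B)} {W : Set (StrongDual ℝ B)}
    (hW : IsOpen W) (hJt : ContDiffOn ℝ ∞ Jt W) (hF : ContDiffOn ℝ ∞ F W)
    {p : ℝ × StrongDual ℝ B} (hp : p.2 ∈ W)
    (hinv : (interpolatedSymplector hB i Jt F p).IsInvertible)
    (h₀ : F p.2 = 0) (h₁ : fderiv ℝ F p.2 = 0) : fderiv ℝ (moserField hB i Jt F) p = 0 := by
  have hN : HasFDerivAt (fun p => (interpolatedSymplector hB i Jt F p).inverse) _ p :=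
    (((contDiffOn_inverse_interpolatedSymplector hW hJt hF).contDiffAt
      ((isOpen_invertible_interpolatedSymplector hW hJt hF).mem_nhds ⟨hp, hinv⟩)).differentiableAt
        (by simp)).hasFDerivAt
  have hF' : HasFDerivAt F (0 : StrongDual ℝ B →L[ℝ] StrongDual ℝ (StrongDual ℝ B)) p.2 :=
    h₁ ▸ ((hF.contDiffAt (hW.mem_nhds hp)).differentiableAt (by simp)).hasFDerivAt
  have hf : HasFDerivAt (fun p : ℝ × StrongDual ℝ B => hB.equiv.symm (F p.2)) _ p :=
    (hB.equiv.symm.toContinuousLinearEquiv.toContinuousLinearMap.hasFDerivAt (x := F p.2)).comp p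
      (hF'.comp p hasFDerivAt_snd)
  refine ((hN.clm_apply hf).neg).fderiv.trans ?_
  rw [h₀, ContinuousLinearMap.zero_comp, ContinuousLinearMap.comp_zero,
    ContinuousLinearMap.comp_zero, map_zero, map_zero, add_zero, neg_zero]

end Field

section Assembly

open unitInterval

variable {B H : Type*} [NormedAddCommGroup B] [NormedSpace ℝ B] [CompleteSpace B]
  [NormedAddCommGroup H] [InnerProductSpace ℝ H] {hB : IsReflexive B} {i : B →L[ℝ] H}

/-- The flow of the Moser field exists on `[0, 1]` near `u₀`, is smooth, and moves `u` by at most a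
multiple of `‖F u‖`. -/
theorem exists_moserFlow {Jt : StrongDual ℝ B → (B →L[ℝ] B)}
    {F : StrongDual ℝ B → StrongDual ℝ (StrongDual ℝ B)} {W : Set (StrongDual ℝ B)}
    (hW : IsOpen W) (hJt : ContDiffOn ℝ ∞ Jt W) (hF : ContDiffOn ℝ ∞ F W)
    {u₀ : StrongDual ℝ B} (hu₀ : u₀ ∈ W) (hinv : (Jt u₀).IsInvertible)
    (hF₀ : F u₀ = 0) (hDF₀ : fderiv ℝ F u₀ = 0) :
    ∃ V : Set (StrongDual ℝ B), IsOpen V ∧ u₀ ∈ V ∧ V ⊆ W ∧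
      ∃ (Γ : StrongDual ℝ B → C(I, B)) (C : ℝ), 0 < C ∧ ContDiffOn ℝ ∞ Γ V ∧
        ∀ u ∈ V, ‖Γ u‖ ≤ C * ‖F u‖ ∧ Γ u 0 = 0 ∧ (∀ h, fderiv ℝ Γ u h 0 = 0) ∧
          ∀ t : I, u + toDualB i (i (Γ u t)) ∈ W ∧
            (interpolatedSymplector hB i Jt F (t, u + toDualB i (i (Γ u t)))).IsInvertible ∧
            HasDerivWithinAt (Set.IccExtend zero_le_one (Γ u))
              (moserField hB i Jt F (t, u + toDualB i (i (Γ u t)))) I t ∧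
            ∀ h, HasDerivWithinAt (Set.IccExtend zero_le_one (fderiv ℝ Γ u h))
              (fderiv ℝ (moserField hB i Jt F) (t, u + toDualB i (i (Γ u t)))
                (0, h + toDualB i (i (fderiv ℝ Γ u h t)))) I t := by
  set O₀ : Set (ℝ × StrongDual ℝ B) :=
    {p | p.2 ∈ W ∧ (interpolatedSymplector hB i Jt F p).IsInvertible} with hO₀def
  have hO₀ : IsOpen O₀ := isOpen_invertible_interpolatedSymplector hW hJt hF
  have hbase : ∀ t : ℝ, interpolatedSymplector hB i Jt F (t, u₀) = Jt u₀ := fun t => by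
    simp [interpolatedSymplector, hDF₀]
  set c : ℝ := ‖(Jt u₀).inverse‖ + 1 with hc
  have hcpos : 0 < c := by positivity
  set O₁ : Set (ℝ × StrongDual ℝ B) := O₀ ∩
    (fun p => (interpolatedSymplector hB i Jt F p).inverse) ⁻¹' Metric.ball 0 c with hO₁def
  have hO₁ : IsOpen O₁ := (contDiffOn_inverse_interpolatedSymplector hW hJt
    hF).continuousOn.isOpen_inter_preimage hO₀ Metric.isOpen_ball
  have hmem₁ : I ×ˢ {u₀} ⊆ O₁ := by
    rintro ⟨t, u⟩ ⟨-, rfl⟩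
    refine ⟨⟨hu₀, by rwa [hbase]⟩, ?_⟩
    simp [hbase, hc]
  obtain ⟨T, W₁, hT, hW₁, hIT, huW₁, hTW⟩ :=
    generalized_tube_lemma isCompact_Icc isCompact_singleton hO₁ hmem₁
  set j : B →L[ℝ] StrongDual ℝ B := toDualB i ∘L i with hj
  set κ : NNReal := ⟨1 / (2 * c * (‖j‖ + 1)), by positivity⟩ with hκ
  have hκpos : 0 < κ := by
    rw [← NNReal.coe_pos]
    change 0 < 1 / (2 * c * (‖j‖ + 1))
    positivity
  have hstrict : HasStrictFDerivAt F
      (0 : StrongDual ℝ B →L[ℝ] StrongDual ℝ (StrongDual ℝ B)) u₀ :=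
    hDF₀ ▸ (hF.contDiffAt (hW.mem_nhds hu₀)).hasStrictFDerivAt (by simp)
  obtain ⟨s, hs, hlip⟩ := hstrict.exists_lipschitzOnWith_of_nnnorm_lt κ (by simpa using hκpos)
  have huO : ∀ t : I, ((t : ℝ), u₀) ∈ T ×ˢ (W₁ ∩ interior s) := fun t =>
    ⟨hIT t.2, huW₁ rfl, mem_interior_iff_mem_nhds.2 hs⟩
  have hsub : T ×ˢ (W₁ ∩ interior s) ⊆ O₁ :=
    (Set.prod_mono_right Set.inter_subset_left).trans hTW
  obtain ⟨V, hV, huV, Γ, hΓ, hflow⟩ := exists_smooth_flow j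
    (hT.prod (hW₁.inter isOpen_interior))
    ((contDiffOn_moserField (hB := hB) (i := i) hW hJt hF).mono fun p hp => (hsub hp).1)
    huO (fun t => moserField_eq_zero hF₀)
    (fun t h => by
      rw [fderiv_moserField_eq_zero hW hJt hF (p := (↑t, u₀)) hu₀ (hsub (huO t)).1.2 hF₀ hDF₀]
      rfl)
  have hVs : ∀ u ∈ V, u ∈ W ∧ u ∈ s := fun u hu => by
    obtain ⟨h0, -, h1⟩ := hflow u hu
    have h2 := (h1 0).1
    rw [h0, map_zero, add_zero] at h2
    exact ⟨(hsub h2).1.1, interior_subset h2.2.2⟩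
  refine ⟨V, hV, huV, fun u hu => (hVs u hu).1, Γ, 2 * c, by positivity, hΓ, fun u hu => ?_⟩
  obtain ⟨h0, h0', h1⟩ := hflow u hu
  refine ⟨?_, h0, h0', fun t => ⟨(hsub (h1 t).1).1.1, (hsub (h1 t).1).1.2, (h1 t).2.1,
    (h1 t).2.2⟩⟩
  have hX : ∀ t : I, ‖moserField hB i Jt F (t, u + j (Γ u t))‖ ≤ c * ‖F u‖ + ‖Γ u‖ / 2 := by
    intro t
    have h2 : ‖(interpolatedSymplector hB i Jt F (t, u + j (Γ u t))).inverse‖ ≤ c := by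
      simpa using (Metric.mem_ball.1 (hsub (h1 t).1).2).le
    have h3 : ‖F (u + j (Γ u t)) - F u‖ ≤ κ * ‖j (Γ u t)‖ := by
      simpa using hlip.norm_sub_le (interior_subset (h1 t).1.2.2) (hVs u hu).2
    have h4 : ‖j (Γ u t)‖ ≤ (‖j‖ + 1) * ‖Γ u‖ := (j.le_opNorm _).trans <| by
      gcongr
      · linarith
      · exact (Γ u).norm_coe_le_norm t
    have h5 : ‖F (u + j (Γ u t))‖ ≤ ‖F u‖ + κ * ((‖j‖ + 1) * ‖Γ u‖) := by
      have := norm_le_norm_add_norm_sub' (F (u + j (Γ u t))) (F u)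
      have h6 : κ * ‖j (Γ u t)‖ ≤ κ * ((‖j‖ + 1) * ‖Γ u‖) := by gcongr
      linarith
    have h7 : c * (κ * ((‖j‖ + 1) * ‖Γ u‖)) = ‖Γ u‖ / 2 := by
      change c * (1 / (2 * c * (‖j‖ + 1)) * ((‖j‖ + 1) * ‖Γ u‖)) = _
      have : ‖j‖ + 1 ≠ 0 := by positivity
      field_simp
    calc ‖moserField hB i Jt F (t, u + j (Γ u t))‖
        ≤ c * ‖F (u + j (Γ u t))‖ := by
          rw [moserField, norm_neg]
          refine (ContinuousLinearMap.le_opNorm _ _).trans ?_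
          rw [LinearIsometryEquiv.norm_map]
          gcongr
      _ ≤ c * (‖F u‖ + κ * ((‖j‖ + 1) * ‖Γ u‖)) := by gcongr
      _ = c * ‖F u‖ + ‖Γ u‖ / 2 := by rw [mul_add, h7]
  have hbound : ‖Γ u‖ ≤ c * ‖F u‖ + ‖Γ u‖ / 2 := by
    refine (ContinuousMap.norm_le _ (by positivity)).2 fun t => ?_
    have h2 := (convex_Icc (0 : ℝ) 1).norm_image_sub_le_of_norm_hasDerivWithin_le
      (f := Set.IccExtend zero_le_one (Γ u)) (x := 0) (y := t)
      (f' := fun τ => moserField hB i Jt F (τ, u + j (Set.IccExtend zero_le_one (Γ u) τ)))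
      (fun τ hτ => by
        rw [Set.IccExtend_of_mem _ _ hτ]
        exact (h1 ⟨τ, hτ⟩).2.1)
      (fun τ hτ => by
        rw [Set.IccExtend_of_mem _ _ hτ]
        exact hX ⟨τ, hτ⟩)
      (Set.left_mem_Icc.2 zero_le_one) t.2
    rw [Set.IccExtend_val, Set.IccExtend_left, sub_zero, Real.norm_of_nonneg t.2.1] at h2
    change ‖Γ u t - Γ u 0‖ ≤ _ at h2
    rw [h0, sub_zero] at h2
    exact h2.trans (mul_le_of_le_one_right (by positivity) t.2.2)
  linarith

/-- The flow of the Moser field pulls `Ω + dF` back to `Ω`. -/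
theorem moserFlow_pullback [CompleteSpace H] {Jt : StrongDual ℝ B → (B →L[ℝ] B)}
    {F : StrongDual ℝ B → StrongDual ℝ (StrongDual ℝ B)} {W : Set (StrongDual ℝ B)}
    {Ω : H → H [⋀^Fin 2]→L[ℝ] ℝ} {U : Set H} (hU : IsOpen U)
    (hW : IsOpen W) (hJt : ContDiffOn ℝ ∞ Jt W) (hF : ContDiffOn ℝ ∞ F W)
    (hΩ : ContDiffOn ℝ ∞ Ω U) (hdΩ : ∀ u ∈ U, extDeriv Ω u = 0)
    (hJ : ∀ u ∈ U, ∀ b, i (Jt (toDualB i u) b) = symplector (Ω u) (i b))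
    {u h k : H} {γ γh γk : C(I, B)} (hγ₀ : γ 0 = 0) (hγh₀ : γh 0 = 0) (hγk₀ : γk 0 = 0)
    (hU' : ∀ t, u + i (γ t) ∈ U) (hW' : ∀ t, toDualB i (u + i (γ t)) ∈ W)
    (hinv : ∀ t : I,
      (interpolatedSymplector hB i Jt F (t, toDualB i (u + i (γ t)))).IsInvertible)
    (hγ : ∀ t : I, HasDerivWithinAt (Set.IccExtend zero_le_one γ)
      (moserField hB i Jt F (t, toDualB i (u + i (γ t)))) I t)
    (hγh : ∀ t : I, HasDerivWithinAt (Set.IccExtend zero_le_one γh)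
      (fderiv ℝ (moserField hB i Jt F) (t, toDualB i (u + i (γ t)))
        (0, toDualB i (h + i (γh t)))) I t)
    (hγk : ∀ t : I, HasDerivWithinAt (Set.IccExtend zero_le_one γk)
      (fderiv ℝ (moserField hB i Jt F) (t, toDualB i (u + i (γ t)))
        (0, toDualB i (k + i (γk t)))) I t) :
    addExtDeriv i Ω F (u + i (γ 1)) ![h + i (γh 1), k + i (γk 1)] = Ω u ![h, k] := by
  set η : H → H [⋀^Fin 2]→L[ℝ] ℝ := fun v =>
    (extDerivOneForm F (toDualB i v)).compContinuousLinearMap (toDualB i) with hη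
  set α : H → H →L[ℝ] ℝ := fun v => (F (toDualB i v)) ∘L toDualB i with hα
  have hαsmooth : ContDiffOn ℝ ∞ α (toDualB i ⁻¹' W) :=
    (hF.comp (toDualB i).contDiff.contDiffOn fun _ hv => hv).clm_comp contDiffOn_const
  have hWo : IsOpen (toDualB i ⁻¹' W) := hW.preimage (toDualB i).continuous
  set αf : H → H [⋀^Fin 1]→L[ℝ] ℝ := fun v =>
    ContinuousAlternatingMap.ofSubsingleton ℝ H ℝ (0 : Fin 1) (α v) with hαf
  have hαfsmooth : ContDiffOn ℝ ∞ αf (toDualB i ⁻¹' W) :=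
    (ContinuousAlternatingMap.ofSubsingletonLIE (𝕜 := ℝ) (E := H) (F := ℝ)
      (0 : Fin 1)).contDiff.comp_contDiffOn hαsmooth
  have htwo : minSmoothness ℝ 2 ≤ ∞ := by
    rw [minSmoothness_of_isRCLikeNormedField]
    exact WithTop.coe_le_coe.2 (le_top : (2 : ℕ∞) ≤ ⊤)
  have hηeq : ∀ v ∈ toDualB i ⁻¹' W, η v = extDeriv αf v := fun v hv => by
    have hd : DifferentiableAt ℝ (fun u => ContinuousAlternatingMap.ofSubsingleton ℝ
        (StrongDual ℝ B) ℝ (0 : Fin 1) (F u)) (toDualB i v) :=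
      (ContinuousAlternatingMap.ofSubsingletonLIE (𝕜 := ℝ) (E := StrongDual ℝ B) (F := ℝ)
        (0 : Fin 1)).differentiableAt.comp _
          ((hF.contDiffAt (hW.mem_nhds hv)).differentiableAt (by simp))
    have h1 := extDeriv_pullback (r := ∞) hd (toDualB i).contDiff.contDiffAt htwo
    simp only [ContinuousLinearMap.fderiv] at h1
    exact h1.symm
  have hηev : ∀ v ∈ toDualB i ⁻¹' W, η =ᶠ[𝓝 v] extDeriv αf := fun v hv =>
    Filter.eventually_of_mem (hWo.mem_nhds hv) hηeq
  have hηd : ∀ v ∈ toDualB i ⁻¹' W, DifferentiableAt ℝ η v := fun v hv => by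
    refine DifferentiableAt.congr_of_eventuallyEq ?_ (hηev v hv)
    have h1 : DifferentiableAt ℝ (fderiv ℝ αf) v :=
      ((hαfsmooth.fderiv_of_isOpen (m := ∞) hWo (by simp)).contDiffAt
        (hWo.mem_nhds hv)).differentiableAt (by simp)
    exact (ContinuousAlternatingMap.alternatizeUncurryFinCLM ℝ H ℝ).differentiableAt.comp v h1
  have hdη : ∀ v ∈ toDualB i ⁻¹' W, extDeriv η v = 0 := fun v hv => by
    rw [(hηev v hv).extDeriv_eq]
    exact extDeriv_extDeriv_apply (hαfsmooth.contDiffAt (hWo.mem_nhds hv)) htwo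
  have hαd : ∀ v ∈ toDualB i ⁻¹' W, DifferentiableAt ℝ α v := fun v hv =>
    (hαsmooth.contDiffAt (hWo.mem_nhds hv)).differentiableAt (by simp)
  set x : ℝ → H := fun τ => u + i (Set.IccExtend zero_le_one γ τ) with hx
  set a : ℝ → H := fun τ => h + i (Set.IccExtend zero_le_one γh τ) with ha
  set b : ℝ → H := fun τ => k + i (Set.IccExtend zero_le_one γk τ) with hb
  have hderiv : ∀ t ∈ I, HasDerivWithinAt
      (fun τ => Ω (x τ) ![a τ, b τ] + τ * η (x τ) ![a τ, b τ]) 0 I t := by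
    intro t ht
    have hxt : x t = u + i (γ ⟨t, ht⟩) := by simp only [hx, Set.IccExtend_of_mem _ _ ht]
    have hat : a t = h + i (γh ⟨t, ht⟩) := by simp only [ha, Set.IccExtend_of_mem _ _ ht]
    have hbt : b t = k + i (γk ⟨t, ht⟩) := by simp only [hb, Set.IccExtend_of_mem _ _ ht]
    have hxU : x t ∈ U := hxt ▸ hU' ⟨t, ht⟩
    have hxW : x t ∈ toDualB i ⁻¹' W := hxt ▸ hW' ⟨t, ht⟩
    have hxinv : (interpolatedSymplector hB i Jt F (t, toDualB i (x t))).IsInvertible :=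
      hxt ▸ hinv ⟨t, ht⟩
    have hO : IsOpen {p : ℝ × StrongDual ℝ B | p.2 ∈ W ∧
      (interpolatedSymplector hB i Jt F p).IsInvertible} :=
      isOpen_invertible_interpolatedSymplector hW hJt hF
    have hXd : DifferentiableAt ℝ (moserField hB i Jt F) (t, toDualB i (x t)) :=
      ((contDiffOn_moserField hW hJt hF).contDiffAt
        (hO.mem_nhds (show (t, toDualB i (x t)) ∈ _ from ⟨hxW, hxinv⟩))).differentiableAt (by simp)
    have hι : HasFDerivAt (fun v : H => ((t, toDualB i v) : ℝ × StrongDual ℝ B))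
        ((0 : H →L[ℝ] ℝ).prod (toDualB i)) (x t) :=
      (hasFDerivAt_const t (x t)).prodMk (toDualB i).hasFDerivAt
    have hYd : HasFDerivAt (fun v => moserField hB i Jt F (t, toDualB i v))
        (fderiv ℝ (moserField hB i Jt F) (t, toDualB i (x t)) ∘L
          (0 : H →L[ℝ] ℝ).prod (toDualB i)) (x t) :=
      HasFDerivAt.comp (g := moserField hB i Jt F) (x t) hXd.hasFDerivAt hι
    refine hasDerivWithinAt_moser (α := α) (Y := fun v => i (moserField hB i Jt F (t, toDualB i v)))
      (Y' := i ∘L fderiv ℝ (moserField hB i Jt F) (t, toDualB i (x t)) ∘L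
        (0 : H →L[ℝ] ℝ).prod (toDualB i))
      ((hΩ.contDiffAt (hU.mem_nhds hxU)).differentiableAt (by simp)) (hηd _ hxW) (hαd _ hxW)
      (hdΩ _ hxU) (hdη _ hxW) ?_ (i.hasFDerivAt.comp (x t) hYd) ?_
      ?_ ?_ ?_
    · intro v w
      rw [hηeq _ hxW]
      exact extDeriv_apply_two (hαd _ hxW) v w
    · have hev : ∀ᶠ v in 𝓝 (x t), ((t, toDualB i v) : ℝ × StrongDual ℝ B) ∈
          {p : ℝ × StrongDual ℝ B | p.2 ∈ W ∧
            (interpolatedSymplector hB i Jt F p).IsInvertible} :=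
        hι.continuousAt.eventually (hO.mem_nhds ⟨hxW, hxinv⟩)
      filter_upwards [hev, hU.mem_nhds hxU] with v hv hvU w
      exact moserField_spec (hJ v hvU)
        ((hF.contDiffAt (hW.mem_nhds hv.1)).differentiableAt (by simp)) hv.2 w
    · rw [hxt]
      exact (i.hasFDerivAt.comp_hasDerivWithinAt t (hγ ⟨t, ht⟩)).const_add u
    · rw [hxt, hat]
      exact (i.hasFDerivAt.comp_hasDerivWithinAt t (hγh ⟨t, ht⟩)).const_add h
    · rw [hxt, hbt]
      exact (i.hasFDerivAt.comp_hasDerivWithinAt t (hγk ⟨t, ht⟩)).const_add k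
  have hconst := (convex_Icc (0 : ℝ) 1).norm_image_sub_le_of_norm_hasDerivWithin_le
    (C := 0) hderiv (by simp) (Set.left_mem_Icc.2 zero_le_one) (Set.right_mem_Icc.2 zero_le_one)
  have hx0 : x 0 = u := by
    change u + i (Set.IccExtend zero_le_one γ 0) = u
    rw [Set.IccExtend_left]
    exact (congrArg (fun z => u + i z) hγ₀).trans (by simp)
  have ha0 : a 0 = h := by
    change h + i (Set.IccExtend zero_le_one γh 0) = h
    rw [Set.IccExtend_left]
    exact (congrArg (fun z => h + i z) hγh₀).trans (by simp)
  have hb0 : b 0 = k := by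
    change k + i (Set.IccExtend zero_le_one γk 0) = k
    rw [Set.IccExtend_left]
    exact (congrArg (fun z => k + i z) hγk₀).trans (by simp)
  have hx1 : x 1 = u + i (γ 1) := by
    change u + i (Set.IccExtend zero_le_one γ 1) = _
    rw [Set.IccExtend_right]
    rfl
  have ha1 : a 1 = h + i (γh 1) := by
    change h + i (Set.IccExtend zero_le_one γh 1) = _
    rw [Set.IccExtend_right]
    rfl
  have hb1 : b 1 = k + i (γk 1) := by
    change k + i (Set.IccExtend zero_le_one γk 1) = _
    rw [Set.IccExtend_right]
    rfl
  rw [hx0, ha0, hb0, hx1, ha1, hb1, zero_mul, zero_mul, add_zero, one_mul, norm_le_zero_iff,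
    sub_eq_zero] at hconst
  exact hconst

end Assembly

end Darboux

end

/-- The regularity norm `‖F(u)‖_B` is the norm of `F u` in the bidual of `B`, which is `B` itself
by the canonical isometry. The map `ψ` is `u ↦ φ(u) - u`, with values in `B`, and `φH` is the map
induced by `φ` on `H ⊂ B*`. -/
theorem proposition5 {B H : Type*} [NormedAddCommGroup B] [NormedSpace ℝ B] [CompleteSpace B]
    [NormedAddCommGroup H] [InnerProductSpace ℝ H] [CompleteSpace H]
    (hB : Darboux.IsReflexive B)
    (i : B →L[ℝ] H) (hi : Function.Injective i) (hdense : DenseRange i)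
    (U₁ : Set H) (hU₁ : IsOpen U₁)
    (U₂ : Set (StrongDual ℝ B)) (hU₂ : IsOpen U₂)
    (hU : ∀ u ∈ U₁, Darboux.toDualB i u ∈ U₂)
    (Ω₁ : H → H [⋀^Fin 2]→L[ℝ] ℝ) (hΩ₁ : Darboux.IsCompatibleSymplecticForm i U₁ Ω₁)
    (F : StrongDual ℝ B → StrongDual ℝ (StrongDual ℝ B)) (hF : ContDiffOn ℝ ∞ F U₂)
    (u₀ : H) (hu₀ : u₀ ∈ U₁)
    (hF₀ : F (Darboux.toDualB i u₀) = 0) (hDF₀ : fderiv ℝ F (Darboux.toDualB i u₀) = 0) :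
    ∃ V : Set (StrongDual ℝ B), IsOpen V ∧ Darboux.toDualB i u₀ ∈ V ∧ V ⊆ U₂ ∧
      ∃ (φ : StrongDual ℝ B → StrongDual ℝ B) (ψ : StrongDual ℝ B → B) (φH : H → H) (C : ℝ),
        0 < C ∧
        ContDiffOn ℝ ∞ φ V ∧
        ContDiffOn ℝ ∞ ψ V ∧
        (∀ u ∈ V, φ u = u + Darboux.toDualB i (i (ψ u))) ∧
        (∀ u ∈ V, ‖ψ u‖ ≤ C * ‖F u‖) ∧
        (∀ u : H, Darboux.toDualB i u ∈ V →
          Darboux.toDualB i (φH u) = φ (Darboux.toDualB i u)) ∧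
        ContDiffOn ℝ ∞ φH (Darboux.toDualB i ⁻¹' V) ∧
        (∀ u : H, Darboux.toDualB i u ∈ V →
          Metric.closedBall u (C * ‖F (Darboux.toDualB i u)‖) ⊆ U₁ →
            φH u ∈ U₁ ∧ Darboux.pullback φH (Darboux.addExtDeriv i Ω₁ F) u = Ω₁ u) := by
  obtain ⟨hsympl, V', hV', hUV', Jt, Kt, hJt, -, hJK⟩ := hΩ₁
  have hJ : ∀ u ∈ U₁, ∀ b, i (Jt (Darboux.toDualB i u) b) = Darboux.symplector (Ω₁ u) (i b) :=
    fun u hu b => (hJK u hu b).1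
  have hinv₀ : (Jt (Darboux.toDualB i u₀)).IsInvertible := by
    refine ⟨ContinuousLinearEquiv.equivOfInverse (Jt (Darboux.toDualB i u₀))
      (Kt (Darboux.toDualB i u₀)) (fun b => hi ?_) (fun b => hi ?_), rfl⟩
    · rw [(hJK u₀ hu₀ _).2, (hJK u₀ hu₀ _).1]
      exact (hsympl.nondegenerate u₀ hu₀).inverse_apply_self (i b)
    · rw [(hJK u₀ hu₀ _).1, (hJK u₀ hu₀ _).2]
      exact (hsympl.nondegenerate u₀ hu₀).self_apply_inverse (i b)
  have hW : IsOpen (V' ∩ U₂) := hV'.inter hU₂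
  obtain ⟨V, hV, huV, hVW, Γ, c, hc, hΓ, hflow⟩ := Darboux.exists_moserFlow (hB := hB) (i := i) hW
    (hJt.mono Set.inter_subset_left) (hF.mono Set.inter_subset_right)
    ⟨hUV' u₀ hu₀, hU u₀ hu₀⟩ hinv₀ hF₀ hDF₀
  have hψ : ContDiffOn ℝ ∞ (fun u => Γ u 1) V :=
    ContDiff.comp_contDiffOn (g := fun γ : C(unitInterval, B) => γ 1)
      (ContinuousMap.evalCLM ℝ (1 : unitInterval) : C(unitInterval, B) →L[ℝ] B).contDiff hΓ
  have hψH : ContDiffOn ℝ ∞ (fun u : H => i (Γ (Darboux.toDualB i u) 1))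
      (Darboux.toDualB i ⁻¹' V) :=
    i.contDiff.comp_contDiffOn
      (hψ.comp (Darboux.toDualB i).contDiff.contDiffOn fun _ hu => hu)
  refine ⟨V, hV, huV, hVW.trans Set.inter_subset_right,
    fun u => u + Darboux.toDualB i (i (Γ u 1)), fun u => Γ u 1,
    fun u => u + i (Γ (Darboux.toDualB i u) 1), c * (‖i‖ + 1), by positivity,
    contDiff_id.contDiffOn.add
      ((Darboux.toDualB i ∘L i).contDiff.comp_contDiffOn hψ), hψ, fun _ _ => rfl, fun u hu => ?_,
    fun u _ => by rw [map_add], contDiff_id.contDiffOn.add hψH, fun u hu hball => ?_⟩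
  · refine ((Γ u).norm_coe_le_norm 1).trans ((hflow u hu).1.trans ?_)
    gcongr
    exact le_mul_of_one_le_right hc.le (by linarith [norm_nonneg i])
  · obtain ⟨hbound, h0, h0', h1⟩ := hflow _ hu
    have hmem : ∀ t, u + i (Γ (Darboux.toDualB i u) t) ∈ U₁ := fun t => hball <| by
      rw [Metric.mem_closedBall, dist_eq_norm, add_sub_cancel_left]
      calc ‖i (Γ (Darboux.toDualB i u) t)‖ ≤ ‖i‖ * ‖Γ (Darboux.toDualB i u) t‖ := i.le_opNorm _
        _ ≤ (‖i‖ + 1) * (c * ‖F (Darboux.toDualB i u)‖) := by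
          gcongr
          · linarith
          · exact ((Γ _).norm_coe_le_norm t).trans hbound
        _ = c * (‖i‖ + 1) * ‖F (Darboux.toDualB i u)‖ := by ring
    refine ⟨hmem 1, ?_⟩
    have hΓ' : HasFDerivAt (fun v : H => Γ (Darboux.toDualB i v))
        (fderiv ℝ Γ (Darboux.toDualB i u) ∘L Darboux.toDualB i) u :=
      HasFDerivAt.comp (g := Γ) u (((hΓ.contDiffAt (hV.mem_nhds hu)).differentiableAt
        (by simp)).hasFDerivAt) (Darboux.toDualB i).hasFDerivAt
    have hφ : HasFDerivAt (fun v : H => v + i (Γ (Darboux.toDualB i v) 1))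
        (ContinuousLinearMap.id ℝ H + (i ∘L ContinuousMap.evalCLM ℝ (1 : unitInterval)) ∘L
          (fderiv ℝ Γ (Darboux.toDualB i u) ∘L Darboux.toDualB i)) u :=
      (hasFDerivAt_id u).add
        ((i ∘L ContinuousMap.evalCLM ℝ (1 : unitInterval)).hasFDerivAt.comp u hΓ')
    ext v
    have hv : v = ![v 0, v 1] := by
      ext k
      fin_cases k <;> rfl
    have key := Darboux.moserFlow_pullback (hB := hB) (i := i) (Ω := Ω₁) (u := u) (h := v 0)
      (k := v 1) (γ := Γ (Darboux.toDualB i u))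
      (γh := fderiv ℝ Γ (Darboux.toDualB i u) (Darboux.toDualB i (v 0)))
      (γk := fderiv ℝ Γ (Darboux.toDualB i u) (Darboux.toDualB i (v 1)))
      hU₁ hW (hJt.mono Set.inter_subset_left) (hF.mono Set.inter_subset_right)
      hsympl.smooth hsympl.closed hJ h0 (h0' _) (h0' _) hmem
      (fun t => by rw [map_add]; exact (h1 t).1)
      (fun t => by rw [map_add]; exact (h1 t).2.1)
      (fun t => by rw [map_add]; exact (h1 t).2.2.1)
      (fun t => by rw [map_add, map_add]; exact (h1 t).2.2.2 _)
      (fun t => by rw [map_add, map_add]; exact (h1 t).2.2.2 _)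
    rw [← hv] at key
    rw [← key, Darboux.pullback, hφ.fderiv]
    change Darboux.addExtDeriv i Ω₁ F _ _ = _
    congr 1
    ext k
    fin_cases k <;> rfl
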